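/- Let $G$ be a finite simple graph with vertex set $V(G)$. Its Dani–Mainkar Lie algebra is the $2$-step nilpotent real Lie algebra $\mathcal L(G)=V\oplus\big(\bigwedge^2V\big)/W$, where $V$ is the real vector space with basis $\{x_i\}_{i\in V(G)}$ and $W\subseteq\bigwedge^2V$ is the span of all $x_i\wedge x_j$ with $\{i,j\}$ not an edge of $G$; the bracket is $[x,x']=x\wedge x' \bmod W$ for $x,x'\in V$, and $\big(\bigwedge^2V\big)/W$ is central. Let $H^\bullet(\mathcal L(G))$ be the (Chevalley–Eilenberg) Lie algebra cohomology of $\mathcal L(G)$ with trivial real coefficients, that is, the cohomology $\ker Q/\operatorname{im}Q$ of the exterior algebra $\bigwedge^\bullet\mathcal L(G)^*$ equipped with the odd derivation $Q$ given on linear forms by $Q(\varphi)=\varphi\circ[\cdot,\cdot]$; equivalently, writing $x_i^*$ and $x_{i,j}^*$ for the basis dual to the basis of $\mathcal L(G)$ formed by the $x_i$ and the $x_{i,j}=[x_i,x_j]$ ($\{i,j\}$ an edge, $i<j$ for a fixed order of the vertices), $Q(x_i^*)=0$ and $Q(x_{i,j}^*)=x_i^*x_j^*$. For $n\ge 1$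 let $S_n$ be the star graph with vertices $1,\dots,n+1$ and edges $\{1,2\},\{1,3\},\dots,\{1,n+1\}$, and let $t(S_n)$ be the total dimension of $H^\bullet(\mathcal L(S_n))$ as a real vector space (the sum over all degrees, degree $0$ included). Then, for every $n\ge 1$, $$t(S_n)=2\binom{2n+1}{n}.$$ -/

import Mathlib

noncomputable section

/-! ### The Chevalley-Eilenberg complex of a finite-dimensional real Lie algebra -/

namespace CE

variable (L : Type*) [LieRing L] [LieAlgebra ℝ L]

/-- The underlying vector space of the Cartan-Chevalley-Eilenberg complex of `L` (trivial
coefficients): the full exterior algebra of the dual of `L`. -/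
abbrev Cochain : Type _ := ExteriorAlgebra ℝ (Module.Dual ℝ L)

variable {L}

/-- The interior product by `v : L` on the exterior algebra of the dual of `L`, that is, the odd
derivation with value `φ v` at a linear form `φ`. -/
def interior (v : L) : Cochain L →ₗ[ℝ] Cochain L :=
  CliffordAlgebra.contractLeft (Module.Dual.eval ℝ L v)

/-- The operator `ω ↦ φ ∧ ψ ∧ ι_v ω`. -/
def wedgeInterior (φ ψ : Module.Dual ℝ L) (v : L) : Cochain L →ₗ[ℝ] Cochain L :=
  LinearMap.mulLeft ℝ (ExteriorAlgebra.ι ℝ φ * ExteriorAlgebra.ι ℝ ψ) ∘ₗ interior v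

/-- The Chevalley-Eilenberg differential written in a basis `e` of `L` with dual basis `e^*`:
`d = ½ ∑ e_a^* ∧ e_b^* ∧ ι_[e_a, e_b]`. -/
def differentialOfBasis {κ : Type*} [Fintype κ] (e : Module.Basis κ ℝ L) :
    Cochain L →ₗ[ℝ] Cochain L :=
  (1 / 2 : ℝ) • ∑ a, ∑ b, wedgeInterior (e.coord a) (e.coord b) ⁅e a, e b⁆

variable (L) in
/-- The Chevalley-Eilenberg differential of a finite-dimensional real Lie algebra, with the sign
convention `(d φ) = φ ∘ [ , ]` on linear forms `φ`. It does not depend on the basis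
(`differentialOfBasis_eq`), it is the odd derivation determined by its values on linear forms
(`differential_mul`, `differential_ι`), it raises the degree by one (`differential_mem`) and its
square is zero (`differential_differential`). -/
def differential [FiniteDimensional ℝ L] : Cochain L →ₗ[ℝ] Cochain L :=
  differentialOfBasis (Module.finBasis ℝ L)

lemma wedgeInterior_apply (φ ψ : Module.Dual ℝ L) (v : L) (ω : Cochain L) :
    wedgeInterior φ ψ v ω =
      ExteriorAlgebra.ι ℝ φ * ExteriorAlgebra.ι ℝ ψ * interior v ω := rfl

lemma interior_add (v w : L) : interior (v + w) = interior v + interior w := by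
  simp [interior]

lemma interior_smul (r : ℝ) (v : L) : interior (r • v) = r • interior v := by
  simp [interior]

lemma interior_ι_mul (v : L) (φ : Module.Dual ℝ L) (ω : Cochain L) :
    interior v (ExteriorAlgebra.ι ℝ φ * ω) = φ v • ω - ExteriorAlgebra.ι ℝ φ * interior v ω :=
  CliffordAlgebra.contractLeft_ι_mul _ _ _

lemma interior_algebraMap (v : L) (r : ℝ) : interior v (algebraMap ℝ (Cochain L) r) = 0 :=
  CliffordAlgebra.contractLeft_algebraMap _ _ _

lemma ι_mul_ι (φ ψ : Module.Dual ℝ L) :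
    ExteriorAlgebra.ι ℝ φ * ExteriorAlgebra.ι ℝ ψ =
      -(ExteriorAlgebra.ι ℝ ψ * ExteriorAlgebra.ι ℝ φ) :=
  eq_neg_of_add_eq_zero_left (ExteriorAlgebra.ι_add_mul_swap φ ψ)

section Basis

variable {κ κ' : Type*} [Fintype κ] [Fintype κ'] (e : Module.Basis κ ℝ L)
  (f : Module.Basis κ' ℝ L)

lemma differentialOfBasis_algebraMap (r : ℝ) :
    differentialOfBasis e (algebraMap ℝ (Cochain L) r) = 0 := by
  simp [differentialOfBasis, wedgeInterior_apply, interior_algebraMap]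

lemma differentialOfBasis_ι (φ : Module.Dual ℝ L) :
    differentialOfBasis e (ExteriorAlgebra.ι ℝ φ) =
      (1 / 2 : ℝ) • ∑ a, ∑ b, φ ⁅e a, e b⁆ •
        (ExteriorAlgebra.ι ℝ (e.coord a) * ExteriorAlgebra.ι ℝ (e.coord b)) := by
  have h : ∀ v : L, interior v (ExteriorAlgebra.ι ℝ φ) = algebraMap ℝ (Cochain L) (φ v) :=
    fun v => CliffordAlgebra.contractLeft_ι _ _ _
  simp only [differentialOfBasis, LinearMap.smul_apply, LinearMap.sum_apply, wedgeInterior_apply, h]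
  simp only [← Algebra.commutes, ← Algebra.smul_def]

lemma differentialOfBasis_ι_mul (φ : Module.Dual ℝ L) (ω : Cochain L) :
    differentialOfBasis e (ExteriorAlgebra.ι ℝ φ * ω) =
      differentialOfBasis e (ExteriorAlgebra.ι ℝ φ) * ω -
        ExteriorAlgebra.ι ℝ φ * differentialOfBasis e ω := by
  rw [differentialOfBasis_ι]
  simp only [differentialOfBasis, LinearMap.smul_apply, LinearMap.sum_apply, wedgeInterior_apply,
    smul_mul_assoc, mul_smul_comm, Finset.sum_mul, Finset.mul_sum, ← smul_sub,
    ← Finset.sum_sub_distrib, interior_ι_mul]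
  congr 1
  refine Finset.sum_congr rfl fun a _ => Finset.sum_congr rfl fun b _ => ?_
  rw [mul_sub, mul_smul_comm]
  congr 1
  rw [← mul_assoc, ← mul_assoc]
  congr 1
  rw [mul_assoc, ι_mul_ι (e.coord b) φ, mul_neg, ← mul_assoc, ι_mul_ι (e.coord a) φ, neg_mul,
    neg_neg, mul_assoc]

/-- The canonical element `∑ e_a^* ⊗ e_a` does not depend on the basis. -/
lemma sum_coord_eq {X : Type*} [AddCommGroup X] [Module ℝ X]
    (B : Module.Dual ℝ L →ₗ[ℝ] L →ₗ[ℝ] X) :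
    ∑ a, B (e.coord a) (e a) = ∑ c, B (f.coord c) (f c) := by
  have h1 : ∀ c, f.coord c = ∑ a, f.coord c (e a) • e.coord a := by
    intro c
    refine e.ext fun a' => ?_
    classical
    simp [Finsupp.single_apply]
  have h2 : ∀ a, e a = ∑ c, f.coord c (e a) • f c := fun a => (f.sum_repr (e a)).symm
  calc ∑ a, B (e.coord a) (e a)
      = ∑ a, ∑ c, f.coord c (e a) • B (e.coord a) (f c) := by
        refine Finset.sum_congr rfl fun a _ => ?_
        conv_lhs => rw [h2 a]
        rw [map_sum]
        exact Finset.sum_congr rfl fun c _ => map_smul _ _ _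
    _ = ∑ c, ∑ a, f.coord c (e a) • B (e.coord a) (f c) := Finset.sum_comm
    _ = ∑ c, B (f.coord c) (f c) := by
        refine Finset.sum_congr rfl fun c _ => ?_
        conv_rhs => rw [h1 c]
        simp

/-- `d φ`, for a linear form `φ` with `φ ∘ [ , ] = ∑ (α_i ⊗ β_i - β_i ⊗ α_i)`, is
`∑ α_i ∧ β_i`. -/
lemma differentialOfBasis_ι_of_bracket {σ : Type*} (s : Finset σ) (α β : σ → Module.Dual ℝ L)
    (φ : Module.Dual ℝ L) (h : ∀ u v, φ ⁅u, v⁆ = ∑ i ∈ s, (α i u * β i v - β i u * α i v)) :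
    differentialOfBasis e (ExteriorAlgebra.ι ℝ φ) =
      ∑ i ∈ s, ExteriorAlgebra.ι ℝ (α i) * ExteriorAlgebra.ι ℝ (β i) := by
  have hx : ∀ ψ : Module.Dual ℝ L, ∑ a, ψ (e a) • e.coord a = ψ := by
    intro ψ
    refine e.ext fun a' => ?_
    classical
    simp
  have key : ∀ ψ χ : Module.Dual ℝ L, ∑ a, ∑ b, (ψ (e a) * χ (e b)) •
      (ExteriorAlgebra.ι ℝ (e.coord a) * ExteriorAlgebra.ι ℝ (e.coord b)) =
      ExteriorAlgebra.ι ℝ ψ * ExteriorAlgebra.ι ℝ χ := by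
    intro ψ χ
    conv_rhs => rw [← hx ψ, ← hx χ]
    simp only [map_sum, map_smul, Finset.sum_mul_sum, smul_mul_smul_comm]
  rw [differentialOfBasis_ι]
  simp only [h, Finset.sum_smul]
  have h3 : ∀ a : κ, ∑ b, ∑ i ∈ s, (α i (e a) * β i (e b) - β i (e a) * α i (e b)) •
      (ExteriorAlgebra.ι ℝ (e.coord a) * ExteriorAlgebra.ι ℝ (e.coord b)) =
      ∑ i ∈ s, ∑ b, (α i (e a) * β i (e b) - β i (e a) * α i (e b)) •
      (ExteriorAlgebra.ι ℝ (e.coord a) * ExteriorAlgebra.ι ℝ (e.coord b)) :=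
    fun a => Finset.sum_comm
  simp only [h3]
  rw [Finset.sum_comm, Finset.smul_sum]
  refine Finset.sum_congr rfl fun i _ => ?_
  simp only [sub_smul, Finset.sum_sub_distrib, key]
  rw [ι_mul_ι (β i) (α i), sub_neg_eq_add, ← two_smul ℝ, smul_smul]
  norm_num

/-- The Chevalley-Eilenberg differential does not depend on the basis. -/
lemma differentialOfBasis_eq : differentialOfBasis e = differentialOfBasis f := by
  classical
  have hι : ∀ φ : Module.Dual ℝ L, differentialOfBasis e (ExteriorAlgebra.ι ℝ φ) =
      differentialOfBasis f (ExteriorAlgebra.ι ℝ φ) := by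
    intro φ
    rw [differentialOfBasis_ι, differentialOfBasis_ι]
    congr 1
    let m : Module.Dual ℝ L → Module.Dual ℝ L → Cochain L := fun p q =>
      ExteriorAlgebra.ι ℝ p * ExteriorAlgebra.ι ℝ q
    let B1 : L → Module.Dual ℝ L → (Module.Dual ℝ L →ₗ[ℝ] L →ₗ[ℝ] Cochain L) := fun u p =>
      LinearMap.mk₂ ℝ (fun q v => φ ⁅u, v⁆ • m p q)
        (by intros; simp [m, mul_add])
        (by intros; simp only [m, map_smul, mul_smul_comm]; exact smul_comm _ _ _)
        (by intros; simp [add_smul]) (by intros; simp [mul_smul])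
    let B2 : L → Module.Dual ℝ L → (Module.Dual ℝ L →ₗ[ℝ] L →ₗ[ℝ] Cochain L) := fun v q =>
      LinearMap.mk₂ ℝ (fun p u => φ ⁅u, v⁆ • m p q)
        (by intros; simp [m, add_mul])
        (by intros; simp only [m, map_smul, smul_mul_assoc]; exact smul_comm _ _ _)
        (by intros; simp [add_smul]) (by intros; simp [mul_smul])
    have s1 : ∀ a, ∑ b, φ ⁅e a, e b⁆ • m (e.coord a) (e.coord b) =
        ∑ c, φ ⁅e a, f c⁆ • m (e.coord a) (f.coord c) :=
      fun a => sum_coord_eq e f (B1 (e a) (e.coord a))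
    have s2 : ∀ c, ∑ a, φ ⁅e a, f c⁆ • m (e.coord a) (f.coord c) =
        ∑ a, φ ⁅f a, f c⁆ • m (f.coord a) (f.coord c) :=
      fun c => sum_coord_eq e f (B2 (f c) (f.coord c))
    change ∑ a, ∑ b, φ ⁅e a, e b⁆ • m (e.coord a) (e.coord b) =
      ∑ a, ∑ b, φ ⁅f a, f b⁆ • m (f.coord a) (f.coord b)
    rw [Finset.sum_congr rfl fun a _ => s1 a, Finset.sum_comm,
      Finset.sum_congr rfl fun c _ => s2 c, Finset.sum_comm]
  refine LinearMap.ext fun ω => ?_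
  induction ω using CliffordAlgebra.left_induction with
  | algebraMap r =>
    exact (differentialOfBasis_algebraMap e r).trans (differentialOfBasis_algebraMap f r).symm
  | add x y hx hy => rw [map_add, map_add, hx, hy]
  | ι_mul x φ hx =>
    exact (differentialOfBasis_ι_mul e φ x).trans
      (by rw [hx, hι]; exact (differentialOfBasis_ι_mul f φ x).symm)

end Basis

section Differential

variable [FiniteDimensional ℝ L]

lemma differential_algebraMap (r : ℝ) : differential L (algebraMap ℝ (Cochain L) r) = 0 :=
  differentialOfBasis_algebraMap _ r

/-- The value of the differential at a linear form: `½ ∑ φ([e_a, e_b]) e_a^* ∧ e_b^*`, the two-form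
`φ ∘ [ , ]`. -/
lemma differential_ι {κ : Type*} [Fintype κ] (e : Module.Basis κ ℝ L) (φ : Module.Dual ℝ L) :
    differential L (ExteriorAlgebra.ι ℝ φ) =
      (1 / 2 : ℝ) • ∑ a, ∑ b, φ ⁅e a, e b⁆ •
        (ExteriorAlgebra.ι ℝ (e.coord a) * ExteriorAlgebra.ι ℝ (e.coord b)) := by
  rw [differential, differentialOfBasis_eq _ e, differentialOfBasis_ι]

lemma differential_ι_mul (φ : Module.Dual ℝ L) (ω : Cochain L) :
    differential L (ExteriorAlgebra.ι ℝ φ * ω) =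
      differential L (ExteriorAlgebra.ι ℝ φ) * ω - ExteriorAlgebra.ι ℝ φ * differential L ω :=
  differentialOfBasis_ι_mul _ φ ω

/-- The differential is an odd derivation; `CliffordAlgebra.involute` multiplies a homogeneous
element of degree `k` by `(-1)^k`. -/
lemma differential_mul (ω η : Cochain L) :
    differential L (ω * η) =
      differential L ω * η + CliffordAlgebra.involute ω * differential L η := by
  induction ω using CliffordAlgebra.left_induction with
  | algebraMap r =>
    have h := differential_algebraMap (L := L) r
    rw [h, zero_mul, zero_add, AlgHom.commutes, ← Algebra.smul_def, ← Algebra.smul_def, map_smul]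
  | add x y hx hy => rw [add_mul, map_add, hx, hy, map_add, map_add, add_mul, add_mul]; abel
  | ι_mul x φ hx =>
    rw [mul_assoc]
    refine (differential_ι_mul φ (x * η)).trans ?_
    rw [show differential L (CliffordAlgebra.ι 0 φ * x) = _ from differential_ι_mul φ x, hx,
      map_mul, CliffordAlgebra.involute_ι]
    simp only [mul_add, sub_mul, neg_mul, mul_assoc]
    abel

lemma differential_mem_two (φ : Module.Dual ℝ L) :
    differential L (ExteriorAlgebra.ι ℝ φ) ∈ ⋀[ℝ]^2 (Module.Dual ℝ L) := by
  rw [differential_ι (Module.finBasis ℝ L)]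
  refine Submodule.smul_mem _ _ (Submodule.sum_mem _ fun a _ => Submodule.sum_mem _ fun b _ =>
    Submodule.smul_mem _ _ ?_)
  rw [ExteriorAlgebra.exteriorPower, pow_two]
  exact Submodule.mul_mem_mul ⟨_, rfl⟩ ⟨_, rfl⟩

/-- The differential raises the degree by one. -/
lemma differential_mem (k : ℕ) (ω : Cochain L) (h : ω ∈ ⋀[ℝ]^k (Module.Dual ℝ L)) :
    differential L ω ∈ ⋀[ℝ]^(k + 1) (Module.Dual ℝ L) := by
  induction k generalizing ω with
  | zero =>
    rw [ExteriorAlgebra.exteriorPower, pow_zero, Submodule.mem_one] at h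
    obtain ⟨r, rfl⟩ := h
    rw [differential_algebraMap]
    exact Submodule.zero_mem _
  | succ k ih =>
    rw [ExteriorAlgebra.exteriorPower, pow_succ'] at h
    refine Submodule.mul_induction_on h ?_ ?_
    · rintro _ ⟨φ, rfl⟩ η hη
      rw [differential_ι_mul]
      refine Submodule.sub_mem _ ?_ ?_
      · have := Submodule.mul_mem_mul (differential_mem_two φ) hη
        rw [ExteriorAlgebra.exteriorPower, ← pow_add] at this
        rwa [ExteriorAlgebra.exteriorPower, show k + 1 + 1 = 2 + k by omega]
      · rw [ExteriorAlgebra.exteriorPower, pow_succ']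
        exact Submodule.mul_mem_mul ⟨φ, rfl⟩ (ih η hη)
    · intro x y hx hy
      rw [map_add]
      exact Submodule.add_mem _ hx hy

lemma differential_differential_ι (φ : Module.Dual ℝ L) :
    differential L (differential L (ExteriorAlgebra.ι ℝ φ)) = 0 := by
  classical
  set e := Module.finBasis ℝ L
  set E : Fin (Module.finrank ℝ L) → Cochain L := fun a => ExteriorAlgebra.ι ℝ (e.coord a) with hE
  have hEE : ∀ a b, E a * E b = -(E b * E a) := fun a b => ι_mul_ι _ _
  have hd : ∀ ψ : Module.Dual ℝ L, differential L (ExteriorAlgebra.ι ℝ ψ) =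
      (1 / 2 : ℝ) • ∑ c, ∑ d, ψ ⁅e c, e d⁆ • (E c * E d) := fun ψ => differential_ι e ψ
  have hrep : ∀ v : L, ∀ g : L →ₗ[ℝ] ℝ, ∑ a, e.coord a v * g (e a) = g v := by
    intro v g
    conv_rhs => rw [← e.sum_repr v]
    rw [map_sum]
    exact Finset.sum_congr rfl fun a _ => (map_smul g (e.repr v a) (e a)).symm
  -- the totally antisymmetrised expression, which vanishes by the Jacobi identity
  set S : Cochain L := ∑ b, ∑ c, ∑ d, φ ⁅⁅e c, e d⁆, e b⁆ • (E c * E d * E b) with hS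
  have rot : ∀ b c d, E c * E d * E b = E b * E c * E d := by
    intro b c d
    rw [mul_assoc, hEE d b, mul_neg, ← mul_assoc, hEE c b]; simp
  have hS0 : S = 0 := by
    have r1 : S = ∑ b, ∑ c, ∑ d, φ ⁅⁅e d, e b⁆, e c⁆ • (E c * E d * E b) := by
      rw [hS]
      calc _ = ∑ c, ∑ b, ∑ d, φ ⁅⁅e d, e b⁆, e c⁆ • (E d * E b * E c) := by
            refine Finset.sum_congr rfl fun c _ => ?_
            rw [Finset.sum_comm]
        _ = ∑ c, ∑ b, ∑ d, φ ⁅⁅e d, e b⁆, e c⁆ • (E c * E d * E b) := by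
            simp only [rot _ _ _]
        _ = _ := Finset.sum_comm
    have r2 : S = ∑ b, ∑ c, ∑ d, φ ⁅⁅e b, e c⁆, e d⁆ • (E c * E d * E b) := by
      rw [hS]
      calc _ = ∑ d, ∑ b, ∑ c, φ ⁅⁅e b, e c⁆, e d⁆ • (E b * E c * E d) := rfl
        _ = ∑ d, ∑ b, ∑ c, φ ⁅⁅e b, e c⁆, e d⁆ • (E c * E d * E b) := by
            refine Finset.sum_congr rfl fun d _ => Finset.sum_congr rfl fun b _ =>
              Finset.sum_congr rfl fun c _ => ?_
            rw [rot b c d]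
        _ = _ := by
            rw [Finset.sum_comm]
            exact Finset.sum_congr rfl fun b _ => Finset.sum_comm
    have h3 : S + S + S = 0 := by
      conv_lhs => rw [r2]
      conv_lhs => enter [1, 1]; rw [← r2, hS]
      conv_lhs => enter [1, 2]; rw [← r2, r1]
      simp only [← Finset.sum_add_distrib, ← add_smul, ← map_add]
      refine Finset.sum_eq_zero fun b _ => Finset.sum_eq_zero fun c _ =>
        Finset.sum_eq_zero fun d _ => ?_
      have := lie_jacobi (e b) (e c) (e d)
      have j : ⁅⁅e c, e d⁆, e b⁆ + ⁅⁅e d, e b⁆, e c⁆ + ⁅⁅e b, e c⁆, e d⁆ = 0 := by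
        rw [← lie_skew ⁅e c, e d⁆ (e b), ← lie_skew ⁅e d, e b⁆ (e c), ← lie_skew ⁅e b, e c⁆ (e d),
          ← neg_add, ← neg_add, this, neg_zero]
      rw [j, map_zero, zero_smul]
    have h4 : (3 : ℝ) • S = 0 := by
      rw [← h3]
      module
    exact (smul_eq_zero.mp h4).resolve_left (by norm_num)
  have hEd : ∀ a, differential L (E a) = (1 / 2 : ℝ) • ∑ c, ∑ d, e.coord a ⁅e c, e d⁆ •
      (E c * E d) := fun a => hd _
  have hm : ∀ a b, differential L (E a * E b) =
      differential L (E a) * E b - E a * differential L (E b) :=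
    fun a b => differential_ι_mul _ _
  rw [hd]
  simp only [map_smul, map_sum, hm, smul_sub, Finset.sum_sub_distrib]
  have t1 : ∑ a, ∑ b, φ ⁅e a, e b⁆ • (differential L (E a) * E b) = (1 / 2 : ℝ) • S := by
    rw [Finset.sum_comm, hS, Finset.smul_sum]
    refine Finset.sum_congr rfl fun b _ => ?_
    simp only [hEd, smul_mul_assoc, Finset.sum_mul, smul_comm _ (1 / 2 : ℝ), ← Finset.smul_sum]
    congr 1
    simp only [Finset.smul_sum, smul_smul]
    rw [Finset.sum_comm]
    refine Finset.sum_congr rfl fun c _ => ?_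
    rw [Finset.sum_comm]
    refine Finset.sum_congr rfl fun d _ => ?_
    rw [← Finset.sum_smul]
    congr 1
    let g : L →ₗ[ℝ] ℝ :=
      { toFun := fun v => φ ⁅v, e b⁆
        map_add' := by intros; simp
        map_smul' := by intros; simp }
    rw [show φ ⁅⁅e c, e d⁆, e b⁆ = g ⁅e c, e d⁆ from rfl, ← hrep _ g]
    exact Finset.sum_congr rfl fun a _ => mul_comm _ _
  have t2 : ∑ a, ∑ b, φ ⁅e a, e b⁆ • (E a * differential L (E b)) = -((1 / 2 : ℝ) • S) := by
    rw [hS, Finset.smul_sum, ← Finset.sum_neg_distrib]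
    refine Finset.sum_congr rfl fun a _ => ?_
    simp only [hEd, mul_smul_comm, Finset.mul_sum, smul_comm _ (1 / 2 : ℝ), ← Finset.smul_sum]
    rw [← smul_neg]
    congr 1
    simp only [Finset.smul_sum, smul_smul, ← Finset.sum_neg_distrib]
    rw [Finset.sum_comm]
    refine Finset.sum_congr rfl fun c _ => ?_
    rw [Finset.sum_comm]
    refine Finset.sum_congr rfl fun d _ => ?_
    rw [← Finset.sum_smul, rot a c d, ← neg_smul, mul_assoc]
    congr 1
    let g : L →ₗ[ℝ] ℝ :=
      { toFun := fun v => φ ⁅e a, v⁆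
        map_add' := by intros; simp
        map_smul' := by intros; simp }
    rw [← lie_skew ⁅e c, e d⁆ (e a), map_neg, neg_neg]
    rw [show φ ⁅e a, ⁅e c, e d⁆⁆ = g ⁅e c, e d⁆ from rfl, ← hrep _ g]
    exact Finset.sum_congr rfl fun b _ => mul_comm _ _
  rw [t1, t2, hS0]
  simp

/-- The square of the differential is zero. -/
lemma differential_differential (ω : Cochain L) : differential L (differential L ω) = 0 := by
  induction ω using CliffordAlgebra.left_induction with
  | algebraMap r =>
    have h := differential_algebraMap (L := L) r
    rw [h, map_zero]
  | add x y hx hy => rw [map_add, map_add, hx, hy, add_zero]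
  | ι_mul x φ hx =>
    have hinv : CliffordAlgebra.involute (differential L (ExteriorAlgebra.ι ℝ φ)) =
        differential L (ExteriorAlgebra.ι ℝ φ) := by
      rw [differential_ι (Module.finBasis ℝ L)]
      simp
    rw [show differential L (CliffordAlgebra.ι 0 φ * x) = _ from differential_ι_mul φ x, map_sub,
      differential_mul, hinv, differential_ι_mul, differential_differential_ι, hx]
    simp

variable (L) in
/-- The cohomology `H^•(L)` of the Chevalley-Eilenberg complex, as a real vector space:
`ker d / im d` on the full exterior algebra of the dual. -/
abbrev Cohomology : Type _ :=
  LinearMap.ker (differential L) ⧸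
    (LinearMap.range (differential L)).submoduleOf (LinearMap.ker (differential L))

end Differential

end CE

/-! ### Dani-Mainkar Lie algebras -/

/-- The wedge `v ∧ w` of two vectors, as an element of the second exterior power. -/
def wedge {V : Type*} (v w : V → ℝ) : ⋀[ℝ]^2 (V → ℝ) := exteriorPower.ιMulti ℝ 2 ![v, w]

lemma coe_wedge {V : Type*} (v w : V → ℝ) :
    (wedge v w : ExteriorAlgebra ℝ (V → ℝ)) = ExteriorAlgebra.ι ℝ v * ExteriorAlgebra.ι ℝ w := by
  simp [wedge, ExteriorAlgebra.ιMulti_apply]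

/-- The subspace of the second exterior power generated by the `x_i ∧ x_j` with `{i, j}` not an
edge, where `x_i` is the standard basis of `V → ℝ`. -/
def nonEdges {V : Type*} [DecidableEq V] (G : SimpleGraph V) : Submodule ℝ (⋀[ℝ]^2 (V → ℝ)) :=
  Submodule.span ℝ {ω | ∃ i j, ¬ G.Adj i j ∧ ω = wedge (Pi.single i 1) (Pi.single j 1)}

/-- The Dani-Mainkar Lie algebra of a finite simple graph `G`: the direct sum of the vector space
with basis the vertices and of the quotient of its second exterior power by `nonEdges G`. -/
def DaniMainkar {V : Type*} [DecidableEq V] (G : SimpleGraph V) : Type _ :=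
  (V → ℝ) × ((⋀[ℝ]^2 (V → ℝ)) ⧸ nonEdges G)

namespace DaniMainkar

variable {V : Type*} [DecidableEq V] (G : SimpleGraph V)

instance : AddCommGroup (DaniMainkar G) :=
  inferInstanceAs (AddCommGroup ((V → ℝ) × ((⋀[ℝ]^2 (V → ℝ)) ⧸ nonEdges G)))

instance : Module ℝ (DaniMainkar G) :=
  inferInstanceAs (Module ℝ ((V → ℝ) × ((⋀[ℝ]^2 (V → ℝ)) ⧸ nonEdges G)))

instance [Finite V] : FiniteDimensional ℝ (DaniMainkar G) :=
  inferInstanceAs (FiniteDimensional ℝ ((V → ℝ) × ((⋀[ℝ]^2 (V → ℝ)) ⧸ nonEdges G)))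

/-- The bracket `[v + a, w + b] = v ∧ w mod nonEdges G`, where `v`, `w` are vectors and `a`, `b` are
in the quotient of the second exterior power. -/
instance : Bracket (DaniMainkar G) (DaniMainkar G) where
  bracket x y := (0, (nonEdges G).mkQ (wedge x.1 y.1))

lemma bracket_def (x y : DaniMainkar G) :
    ⁅x, y⁆ = ((0, (nonEdges G).mkQ (wedge x.1 y.1)) : (V → ℝ) × _) := rfl

instance : LieRing (DaniMainkar G) where
  add_lie x y z := by
    have h : wedge (x + y).1 z.1 = wedge x.1 z.1 + wedge y.1 z.1 := by
      apply Subtype.ext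
      rw [Submodule.coe_add, coe_wedge, coe_wedge, coe_wedge, ← add_mul, ← map_add]
      rfl
    rw [bracket_def, bracket_def, bracket_def, h, map_add]
    exact Prod.ext (add_zero 0).symm rfl
  lie_add x y z := by
    have h : wedge x.1 (y + z).1 = wedge x.1 y.1 + wedge x.1 z.1 := by
      apply Subtype.ext
      rw [Submodule.coe_add, coe_wedge, coe_wedge, coe_wedge, ← mul_add, ← map_add]
      rfl
    rw [bracket_def, bracket_def, bracket_def, h, map_add]
    exact Prod.ext (add_zero 0).symm rfl
  lie_self x := by
    have h : wedge x.1 x.1 = 0 := by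
      apply Subtype.ext
      rw [coe_wedge, CliffordAlgebra.ι_sq_scalar]
      simp
    rw [bracket_def, h, map_zero]
    rfl
  leibniz_lie x y z := by
    have h1 : ∀ u : V → ℝ, wedge u 0 = 0 := fun u => Subtype.ext (by rw [coe_wedge]; simp)
    have h2 : ∀ u : V → ℝ, wedge 0 u = 0 := fun u => Subtype.ext (by rw [coe_wedge]; simp)
    have h3 : ∀ u v w : DaniMainkar G, ⁅u, ⁅v, w⁆⁆ = 0 := fun u v w => by
      rw [bracket_def, show (⁅v, w⁆ : DaniMainkar G).1 = 0 from rfl, h1, map_zero]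
      rfl
    have h4 : ∀ u v w : DaniMainkar G, ⁅⁅u, v⁆, w⁆ = 0 := fun u v w => by
      rw [bracket_def, show (⁅u, v⁆ : DaniMainkar G).1 = 0 from rfl, h2, map_zero]
      rfl
    rw [h3, h3, h4, add_zero]

instance : LieAlgebra ℝ (DaniMainkar G) where
  lie_smul t x y := by
    have h : wedge x.1 (t • y).1 = t • wedge x.1 y.1 := by
      apply Subtype.ext
      rw [Submodule.coe_smul, coe_wedge, coe_wedge, ← mul_smul_comm, ← map_smul]
      rfl
    rw [bracket_def, bracket_def, h, map_smul]
    exact Prod.ext (smul_zero t).symm rfl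

/-- The linear form `x_i^*`. -/
def vertexForm (i : V) : Module.Dual ℝ (DaniMainkar G) :=
  LinearMap.proj i ∘ₗ LinearMap.fst ℝ (V → ℝ) ((⋀[ℝ]^2 (V → ℝ)) ⧸ nonEdges G)

/-- The linear form `v ∧ w ↦ v_i w_j - v_j w_i` on the second exterior power. -/
def minorForm {V : Type*} (i j : V) : ⋀[ℝ]^2 (V → ℝ) →ₗ[ℝ] ℝ :=
  exteriorPower.alternatingMapLinearEquiv
    (AlternatingMap.compLinearMap (Matrix.detRowAlternating : (Fin 2 → ℝ) [⋀^Fin 2]→ₗ[ℝ] ℝ)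
      (LinearMap.pi ![LinearMap.proj i, LinearMap.proj j] : (V → ℝ) →ₗ[ℝ] (Fin 2 → ℝ)))

lemma minorForm_wedge {V : Type*} (i j : V) (v w : V → ℝ) :
    minorForm i j (wedge v w) = v i * w j - v j * w i := by
  rw [minorForm, wedge, exteriorPower.alternatingMapLinearEquiv_apply_ιMulti,
    AlternatingMap.compLinearMap_apply]
  exact (Matrix.det_fin_two _).trans (by simp)

variable {G}

lemma nonEdges_le_ker_minorForm {i j : V} (h : G.Adj i j) :
    nonEdges G ≤ LinearMap.ker (minorForm i j) := by
  refine Submodule.span_le.2 ?_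
  rintro _ ⟨k, l, hkl, rfl⟩
  rw [SetLike.mem_coe, LinearMap.mem_ker, minorForm_wedge]
  have h1 : (Pi.single k 1 : V → ℝ) i * (Pi.single l 1 : V → ℝ) j = 0 := by
    by_contra h0
    simp only [Pi.single_apply, mul_ite, mul_one, mul_zero] at h0
    split_ifs at h0 <;> simp_all
  have h2 : (Pi.single k 1 : V → ℝ) j * (Pi.single l 1 : V → ℝ) i = 0 := by
    by_contra h0
    simp only [Pi.single_apply, mul_ite, mul_one, mul_zero] at h0
    split_ifs at h0 <;> simp_all [G.adj_comm]
  rw [h1, h2, sub_zero]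

/-- The linear form `x_{i,j}^*`, for an edge `{i, j}`. -/
def edgeForm {i j : V} (h : G.Adj i j) : Module.Dual ℝ (DaniMainkar G) :=
  (nonEdges G).liftQ (minorForm i j) (nonEdges_le_ker_minorForm h) ∘ₗ
    LinearMap.snd ℝ (V → ℝ) ((⋀[ℝ]^2 (V → ℝ)) ⧸ nonEdges G)

/-- The differential of `x_i^*` is `0`. -/
lemma differential_vertexForm [Finite V] (i : V) :
    CE.differential (DaniMainkar G) (ExteriorAlgebra.ι ℝ (vertexForm G i)) = 0 := by
  rw [CE.differential, CE.differentialOfBasis_ι_of_bracket _ (∅ : Finset Unit)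
    (fun _ => 0) (fun _ => 0)]
  · simp
  · intro u v
    rfl

/-- The differential of `x_{i,j}^*` is `x_i^* ∧ x_j^*`. -/
lemma differential_edgeForm [Finite V] {i j : V} (h : G.Adj i j) :
    CE.differential (DaniMainkar G) (ExteriorAlgebra.ι ℝ (edgeForm h)) =
      ExteriorAlgebra.ι ℝ (vertexForm G i) * ExteriorAlgebra.ι ℝ (vertexForm G j) := by
  rw [CE.differential, CE.differentialOfBasis_ι_of_bracket _ (Finset.univ : Finset Unit)
    (fun _ => vertexForm G i) (fun _ => vertexForm G j)]
  · simp
  · intro u v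
    have h1 : edgeForm h ⁅u, v⁆ = minorForm i j (wedge u.1 v.1) := rfl
    rw [h1, minorForm_wedge]
    simp only [Finset.univ_unique, Finset.sum_const, Finset.card_singleton, one_smul]
    exact congrArg (u.1 i * v.1 j - ·) rfl

end DaniMainkar

end

/-! Write `x` for the form dual to the centre of the star, `y i` for the forms dual to the leaves
and `z i` for those dual to the edges. The complex is the exterior algebra on these `2 n + 1`
generators, with `d x = d (y i) = 0` and `d (z i) = x (y i)`. Since `d` squares to zero, its
homology has dimension `2 ^ (2 n + 1) - 2 rank d`, so only the rank of `d` is needed.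

Let `M` be the exterior algebra on the `y i`, `z i`. The whole complex is `M ⊕ x M`. On `M` the
differential is `x N`, where `N` is the even derivation with `N (z i) = y i` and `N (y i) = 0`; on
`x M` it vanishes because `x x = 0`. Hence `rank d = rank N = 4 ^ n - dim ker N`, and the claim
becomes `dim ker N = (2 n + 1).choose n`.

As a space with a nilpotent operator, `M` is the `n`-th tensor power of the exterior algebra on one
pair `y`, `z`, which has two Jordan blocks of size 1 (spanned by `1` and `y z`) and one of size 2
(`z ↦ y`). A block of size `s` tensored with one of size 2 splits into blocks of sizes `s + 1` and
`s - 1`, the Clebsch-Gordan rule for `sl₂`. In terms of kernels of powers this is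
`finrank_ker_shift_pow`. The resulting recursion for `dim ker N ^ k` mixes neighbouring values of
`k`, so the induction on `n` must treat all `k` together. Its solution is `centralSum n k`, by
`centralSum_succ`, and `k = 1` gives the binomial coefficient.

`exists_model` builds `M` and `N` abstractly, one pair at a time, with a map `Φ` to the exterior
algebra. `finrank_range_add` identifies two copies of `M` with the whole complex by surjectivity and
a dimension count. -/

noncomputable section

open Module

/-! ### Kernels of powers of a nilpotent derivation -/

namespace KernelPow

variable {M : Type*} [AddCommGroup M] [Module ℝ M]

/-- The endomorphism `(a, b) ↦ (N a + b, N b)` of `M × M`. -/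
def shift (N : M →ₗ[ℝ] M) : M × M →ₗ[ℝ] M × M :=
  (N.coprod LinearMap.id).prod (N ∘ₗ LinearMap.snd ℝ M M)

@[simp]
lemma shift_apply (N : M →ₗ[ℝ] M) (p : M × M) : shift N p = (N p.1 + p.2, N p.2) := rfl

/-- This is the binomial theorem: `shift N` is the diagonal action of `N` plus the commuting
operator `(a, b) ↦ (b, 0)`, whose square is zero, so only two terms survive. -/
lemma shift_pow_succ_apply (N : M →ₗ[ℝ] M) (k : ℕ) (p : M × M) :
    (shift N ^ (k + 1)) p =
      ((N ^ (k + 1)) p.1 + ((k : ℝ) + 1) • (N ^ k) p.2, (N ^ (k + 1)) p.2) := by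
  induction k with
  | zero => simp
  | succ k ih =>
    rw [pow_succ', Module.End.mul_apply, ih, shift_apply]
    simp only [map_add, map_smul, ← Module.End.mul_apply, ← pow_succ']
    refine Prod.ext ?_ rfl
    push_cast
    module

/-- The change of coordinates that decomposes the kernel of a power of `shift N`. -/
def kerShiftPowEquiv (N : M →ₗ[ℝ] M) (k : ℕ) :
    LinearMap.ker (shift N ^ (k + 1)) ≃ₗ[ℝ]
      LinearMap.ker (N ^ (k + 2)) × LinearMap.ker (N ^ k) where
  toFun p := (⟨p.1.1, by
      have h := p.2
      rw [LinearMap.mem_ker, shift_pow_succ_apply, Prod.mk_eq_zero] at h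
      -- One more application of `N` turns the second term into a multiple of `N ^ (k + 1)` of the
      -- second coordinate, which is zero.
      have h1 := congrArg N h.1
      simp only [map_add, map_smul, map_zero, ← Module.End.mul_apply, ← pow_succ'] at h1
      rw [h.2, smul_zero, add_zero] at h1
      exact h1⟩, ⟨N p.1.1 + ((k : ℝ) + 1) • p.1.2, by
      have h := p.2
      rw [LinearMap.mem_ker, shift_pow_succ_apply, Prod.mk_eq_zero] at h
      rw [LinearMap.mem_ker, map_add, map_smul, ← Module.End.mul_apply, ← pow_succ]
      exact h.1⟩)
  map_add' p q := by
    ext <;> simp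
    module
  map_smul' r p := by
    ext <;> simp [smul_comm _ r]
  -- Solves `N a + (k + 1) b = q.2` for `b`; characteristic zero enters through this division.
  invFun q := ⟨(q.1.1, ((k : ℝ) + 1)⁻¹ • (q.2.1 - N q.1.1)), by
    have hk : (k : ℝ) + 1 ≠ 0 := by positivity
    have h1 := q.1.2
    have h2 := q.2.2
    rw [LinearMap.mem_ker] at h1 h2
    rw [LinearMap.mem_ker, shift_pow_succ_apply, Prod.mk_eq_zero]
    constructor
    · simp only [map_smul, map_sub, h2, smul_smul, mul_inv_cancel₀ hk, one_smul]
      rw [← Module.End.mul_apply, ← pow_succ]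
      simp
    · simp only [map_smul, map_sub]
      rw [← Module.End.mul_apply (N ^ (k + 1)) N, ← pow_succ, h1, pow_succ', Module.End.mul_apply,
        h2]
      simp⟩
  left_inv p := by
    have hk : (k : ℝ) + 1 ≠ 0 := by positivity
    ext <;> simp [smul_smul, inv_mul_cancel₀ hk]
  right_inv q := by
    have hk : (k : ℝ) + 1 ≠ 0 := by positivity
    ext <;> simp [smul_smul, mul_inv_cancel₀ hk]

/-- Clebsch-Gordan in numerical form: on a nilpotent block of size `s` it reads `min (s+1) (k+1) +
min (s-1) (k+1) = min s (k+2) + min s k`. -/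
lemma finrank_ker_shift_pow [FiniteDimensional ℝ M] (N : M →ₗ[ℝ] M) (k : ℕ) :
    finrank ℝ (LinearMap.ker (shift N ^ (k + 1))) =
      finrank ℝ (LinearMap.ker (N ^ (k + 2))) + finrank ℝ (LinearMap.ker (N ^ k)) := by
  rw [(kerShiftPowEquiv N k).finrank_eq, finrank_prod]

lemma finrank_ker_prodMap [FiniteDimensional ℝ M] {M' : Type*} [AddCommGroup M'] [Module ℝ M']
    [FiniteDimensional ℝ M']
    (f : M →ₗ[ℝ] M) (g : M' →ₗ[ℝ] M') :
    finrank ℝ (LinearMap.ker (f.prodMap g)) =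
      finrank ℝ (LinearMap.ker f) + finrank ℝ (LinearMap.ker g) := by
  let e : (LinearMap.ker f).prod (LinearMap.ker g) ≃ₗ[ℝ] LinearMap.ker f × LinearMap.ker g :=
    { toFun := fun p => (⟨p.1.1, p.2.1⟩, ⟨p.1.2, p.2.2⟩)
      invFun := fun p => ⟨(p.1.1, p.2.1), p.1.2, p.2.2⟩
      map_add' := fun _ _ => rfl
      map_smul' := fun _ _ => rfl
      left_inv := fun _ => rfl
      right_inv := fun _ => rfl }
  rw [LinearMap.ker_prodMap, e.finrank_eq, finrank_prod]

/-- The sum of the `k` binomial coefficients `(2 n + 1).choose (n + 1 + j)`, `j < k`. -/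
def centralSum (n k : ℕ) : ℕ := ∑ j ∈ Finset.range k, (2 * n + 1).choose (n + 1 + j)

lemma centralSum_zero_right (n : ℕ) : centralSum n 0 = 0 := rfl

lemma centralSum_zero_left (k : ℕ) : centralSum 0 (k + 1) = 1 := by
  rw [centralSum, Finset.sum_range_succ', Finset.sum_eq_zero]
  · rfl
  · intro j _
    exact Nat.choose_eq_zero_of_lt (by omega)

lemma centralSum_one (n : ℕ) : centralSum n 1 = (2 * n + 1).choose n := by
  rw [centralSum, Finset.sum_range_one, add_zero, ← Nat.choose_symm_half]

/-- Pascal's rule applied twice splits each coefficient into three. The outer two sums are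
`centralSum` with its range shifted by one place; the boundary terms are the two equal middle
coefficients of row `2 n + 1`, and they cancel. -/
lemma centralSum_succ (n k : ℕ) :
    centralSum (n + 1) (k + 1) =
      2 * centralSum n (k + 1) + (centralSum n (k + 2) + centralSum n k) := by
  have h1 : centralSum n (k + 2) = ∑ j ∈ Finset.range (k + 1), (2 * n + 1).choose (n + 2 + j) +
      (2 * n + 1).choose (n + 1) := by
    rw [centralSum, Finset.sum_range_succ']
    congr 1
    exact Finset.sum_congr rfl fun j _ => by congr 1; omega
  have h2 : ∑ j ∈ Finset.range (k + 1), (2 * n + 1).choose (n + j) =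
      centralSum n k + (2 * n + 1).choose (n + 1) := by
    rw [centralSum, Finset.sum_range_succ', add_zero, Nat.choose_symm_half]
    congr 1
    exact Finset.sum_congr rfl fun j _ => by congr 1; omega
  have h3 : ∀ j, (2 * (n + 1) + 1).choose (n + 1 + 1 + j) =
      (2 * n + 1).choose (n + j) + 2 * (2 * n + 1).choose (n + 1 + j) +
        (2 * n + 1).choose (n + 2 + j) := by
    intro j
    rw [show 2 * (n + 1) + 1 = 2 * n + 1 + 1 + 1 by omega,
      show n + 1 + 1 + j = n + j + 1 + 1 by omega, show n + 1 + j = n + j + 1 by omega,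
      Nat.choose_succ_succ' (2 * n + 1 + 1),
      Nat.choose_succ_succ' (2 * n + 1), Nat.choose_succ_succ' (2 * n + 1)]
    ring
  have h4 : centralSum (n + 1) (k + 1) =
      ∑ j ∈ Finset.range (k + 1), (2 * n + 1).choose (n + j) + 2 * centralSum n (k + 1) +
        ∑ j ∈ Finset.range (k + 1), (2 * n + 1).choose (n + 2 + j) := by
    simp only [centralSum, h3, Finset.sum_add_distrib, Finset.mul_sum]
  omega

/-- The endomorphism of `M ⊕ M² ⊕ M` that is `N` on the outer summands and `shift N` on the middle
one. -/
def quadruple (N : M →ₗ[ℝ] M) : M × (M × M) × M →ₗ[ℝ] M × (M × M) × M :=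
  N.prodMap ((shift N).prodMap N)

lemma quadruple_apply (N : M →ₗ[ℝ] M) (p : M × (M × M) × M) :
    quadruple N p = (N p.1, (N p.2.1.1 + p.2.1.2, N p.2.1.2), N p.2.2) := rfl

lemma prodMap_pow {M' : Type*} [AddCommGroup M'] [Module ℝ M'] (f : M →ₗ[ℝ] M) (g : M' →ₗ[ℝ] M')
    (k : ℕ) : f.prodMap g ^ k = (f ^ k).prodMap (g ^ k) := by
  induction k with
  | zero => exact LinearMap.prodMap_one.symm
  | succ k ih => rw [pow_succ, ih, LinearMap.prodMap_mul, pow_succ, pow_succ]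

/-- The two outer copies of `N` give the term with factor 2 in `centralSum_succ`, and the `shift N`
block gives the two neighbouring terms. -/
lemma finrank_ker_quadruple_pow [FiniteDimensional ℝ M] (N : M →ₗ[ℝ] M) (n : ℕ)
    (h : ∀ k, finrank ℝ (LinearMap.ker (N ^ k)) = centralSum n k) (k : ℕ) :
    finrank ℝ (LinearMap.ker (quadruple N ^ k)) = centralSum (n + 1) k := by
  cases k with
  | zero =>
    rw [pow_zero, show LinearMap.ker (1 : Module.End ℝ (M × (M × M) × M)) = ⊥ from
      LinearMap.ker_id, finrank_bot, centralSum_zero_right]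
  | succ k =>
    rw [quadruple, prodMap_pow, prodMap_pow, finrank_ker_prodMap,
      finrank_ker_prodMap, finrank_ker_shift_pow, h, h, h, centralSum_succ]
    ring

end KernelPow

/-! ### Exterior algebras with a differential that is concentrated on pairs of generators -/

namespace ExteriorPairs

variable {D : Type*} [AddCommGroup D] [Module ℝ D]

open ExteriorAlgebra (ι)

lemma ι_mul_ι_mul_self (φ : D) (ω : ExteriorAlgebra ℝ D) : ι ℝ φ * (ι ℝ φ * ω) = 0 := by
  rw [← mul_assoc, ExteriorAlgebra.ι_sq_zero, zero_mul]

lemma ι_mul_ι_mul (φ ψ : D) (ω : ExteriorAlgebra ℝ D) :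
    ι ℝ φ * (ι ℝ ψ * ω) = -(ι ℝ ψ * (ι ℝ φ * ω)) := by
  rw [← mul_assoc, ← mul_assoc, ← neg_mul,
    eq_neg_of_add_eq_zero_left (ExteriorAlgebra.ι_add_mul_swap φ ψ)]

/-! ### Adjoining one pair of generators -/

section Extend

variable {M : Type*} [AddCommGroup M] [Module ℝ M]

/-- The extension `(a, b, c, e) ↦ Φ a + y Φ b + z Φ c + y z Φ e` of `Φ`. -/
def extend (y z : D) (Φ : M →ₗ[ℝ] ExteriorAlgebra ℝ D) :
    M × (M × M) × M →ₗ[ℝ] ExteriorAlgebra ℝ D :=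
  Φ.coprod (((LinearMap.mulLeft ℝ (ι ℝ y) ∘ₗ Φ).coprod (LinearMap.mulLeft ℝ (ι ℝ z) ∘ₗ Φ)).coprod
    (LinearMap.mulLeft ℝ (ι ℝ y) ∘ₗ LinearMap.mulLeft ℝ (ι ℝ z) ∘ₗ Φ))

lemma extend_apply (y z : D) (Φ : M →ₗ[ℝ] ExteriorAlgebra ℝ D) (p : M × (M × M) × M) :
    extend y z Φ p =
      Φ p.1 + (ι ℝ y * Φ p.2.1.1 + ι ℝ z * Φ p.2.1.2 + ι ℝ y * (ι ℝ z * Φ p.2.2)) := rfl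

lemma mem_range_extend (y z : D) (Φ : M →ₗ[ℝ] ExteriorAlgebra ℝ D) {ω : ExteriorAlgebra ℝ D}
    (h : ω ∈ LinearMap.range Φ) : ω ∈ LinearMap.range (extend y z Φ) := by
  obtain ⟨m, rfl⟩ := h
  exact ⟨(m, (0, 0), 0), by simp [extend_apply]⟩

lemma fst_mul_mem_range_extend (y z : D) (Φ : M →ₗ[ℝ] ExteriorAlgebra ℝ D)
    {ω : ExteriorAlgebra ℝ D} (h : ω ∈ LinearMap.range (extend y z Φ)) :
    ι ℝ y * ω ∈ LinearMap.range (extend y z Φ) := by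
  obtain ⟨⟨a, ⟨b, c⟩, e⟩, rfl⟩ := h
  exact ⟨(0, (a, 0), c), by simp [extend_apply, mul_add, ι_mul_ι_mul_self]⟩

lemma snd_mul_mem_range_extend (y z : D) (Φ : M →ₗ[ℝ] ExteriorAlgebra ℝ D)
    {ω : ExteriorAlgebra ℝ D} (h : ω ∈ LinearMap.range (extend y z Φ)) :
    ι ℝ z * ω ∈ LinearMap.range (extend y z Φ) := by
  obtain ⟨⟨a, ⟨b, c⟩, e⟩, rfl⟩ := h
  exact ⟨(0, (0, a), -b), by
    simp [extend_apply, mul_add, ι_mul_ι_mul_self, ι_mul_ι_mul z y]⟩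

lemma mul_mem_range_extend (y z w : D) (Φ : M →ₗ[ℝ] ExteriorAlgebra ℝ D)
    (hw : ∀ ω ∈ LinearMap.range Φ, ι ℝ w * ω ∈ LinearMap.range Φ)
    {ω : ExteriorAlgebra ℝ D} (h : ω ∈ LinearMap.range (extend y z Φ)) :
    ι ℝ w * ω ∈ LinearMap.range (extend y z Φ) := by
  obtain ⟨⟨a, ⟨b, c⟩, e⟩, rfl⟩ := h
  obtain ⟨a', ha⟩ := hw _ ⟨a, rfl⟩
  obtain ⟨b', hb⟩ := hw _ ⟨b, rfl⟩
  obtain ⟨c', hc⟩ := hw _ ⟨c, rfl⟩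
  obtain ⟨e', he⟩ := hw _ ⟨e, rfl⟩
  exact ⟨(a', (-b', -c'), e'), by
    simp [extend_apply, mul_add, ι_mul_ι_mul w y, ι_mul_ι_mul w z, ha, hb, hc, he]⟩

/-- Moving `x` to the left past `y` or `z` produces a sign that cancels the one in the odd Leibniz
rule, so `N` acts without signs. The only new term comes from `d z = x y`: it sends the `z`
coefficient to the `y` coefficient, and dies on `y z` because `y y = 0`. -/
lemma apply_extend (d : ExteriorAlgebra ℝ D →ₗ[ℝ] ExteriorAlgebra ℝ D)
    (hmul : ∀ φ ω, d (ι ℝ φ * ω) = d (ι ℝ φ) * ω - ι ℝ φ * d ω) {x y z : D} (hy : d (ι ℝ y) = 0)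
    (hz : d (ι ℝ z) = ι ℝ x * ι ℝ y) {N : M →ₗ[ℝ] M}
    {Φ : M →ₗ[ℝ] ExteriorAlgebra ℝ D} (hΦ : ∀ m, d (Φ m) = ι ℝ x * Φ (N m))
    (p : M × (M × M) × M) :
    d (extend y z Φ p) = ι ℝ x * extend y z Φ (KernelPow.quadruple N p) := by
  simp only [extend_apply, KernelPow.quadruple_apply, map_add, hmul, hy, hz, hΦ, mul_add, mul_sub,
    mul_assoc, ι_mul_ι_mul y x, ι_mul_ι_mul z x, ι_mul_ι_mul_self, mul_neg, mul_zero, zero_mul]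
  abel

end Extend

/-- The subalgebra generated by finitely many pairs `y i`, `z i`, presented by a space `M` with an
endomorphism `N` such that the differential is `x N`. -/
lemma exists_model (d : ExteriorAlgebra ℝ D →ₗ[ℝ] ExteriorAlgebra ℝ D)
    (hone : d 1 = 0) (hmul : ∀ φ ω, d (ι ℝ φ * ω) = d (ι ℝ φ) * ω - ι ℝ φ * d ω)
    (x : D) (n : ℕ) (y z : Fin n → D) (hy : ∀ i, d (ι ℝ (y i)) = 0)
    (hz : ∀ i, d (ι ℝ (z i)) = ι ℝ x * ι ℝ (y i)) :
    ∃ (M : Type) (_ : AddCommGroup M) (_ : Module ℝ M) (_ : FiniteDimensional ℝ M)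
      (N : M →ₗ[ℝ] M) (Φ : M →ₗ[ℝ] ExteriorAlgebra ℝ D),
      finrank ℝ M = 4 ^ n ∧
      (∀ k, finrank ℝ (LinearMap.ker (N ^ k)) = KernelPow.centralSum n k) ∧
      (∀ m, d (Φ m) = ι ℝ x * Φ (N m)) ∧ 1 ∈ LinearMap.range Φ ∧
      (∀ i, ∀ ω ∈ LinearMap.range Φ, ι ℝ (y i) * ω ∈ LinearMap.range Φ) ∧
      (∀ i, ∀ ω ∈ LinearMap.range Φ, ι ℝ (z i) * ω ∈ LinearMap.range Φ) := by
  induction n with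
  | zero =>
    -- With no pairs the model is the scalars with `N = 0`. The power `k = 0` is the identity and
    -- has zero kernel, hence the case split on `k`.
    refine ⟨ℝ, inferInstance, inferInstance, inferInstance, 0,
      LinearMap.toSpanSingleton ℝ _ 1, by simp, ?_, by simp [hone], ⟨1, by simp⟩,
      fun i => i.elim0, fun i => i.elim0⟩
    intro k
    cases k with
    | zero =>
      rw [pow_zero, show LinearMap.ker (1 : Module.End ℝ ℝ) = ⊥ from LinearMap.ker_id,
        finrank_bot, KernelPow.centralSum_zero_right]
    | succ k =>
      rw [pow_succ, mul_zero, LinearMap.ker_zero, finrank_top, finrank_self,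
        KernelPow.centralSum_zero_left]
  | succ n ih =>
    obtain ⟨M, _, _, _, N, Φ, hM, hN, hΦ, h1, hyΦ, hzΦ⟩ :=
      ih (fun i => y i.succ) (fun i => z i.succ) (fun i => hy _) (fun i => hz _)
    refine ⟨M × (M × M) × M, inferInstance, inferInstance, inferInstance, KernelPow.quadruple N,
      extend (y 0) (z 0) Φ, ?_, KernelPow.finrank_ker_quadruple_pow N n hN,
      apply_extend d hmul (hy 0) (hz 0) hΦ, mem_range_extend _ _ _ h1, ?_, ?_⟩
    · simp only [finrank_prod, hM]
      ring
    · refine Fin.cases (fun ω h => fst_mul_mem_range_extend _ _ _ h) fun i ω h => ?_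
      exact mul_mem_range_extend _ _ _ _ (hyΦ i) h
    · refine Fin.cases (fun ω h => snd_mul_mem_range_extend _ _ _ h) fun i ω h => ?_
      exact mul_mem_range_extend _ _ _ _ (hzΦ i) h

/-! ### The rank of the differential -/

lemma finrank_exteriorAlgebra [FiniteDimensional ℝ D] :
    finrank ℝ (ExteriorAlgebra ℝ D) = 2 ^ finrank ℝ D := by
  rw [finrank_eq_card_basis (finBasis ℝ D).ExteriorAlgebra, Fintype.card_finset, Fintype.card_fin]

instance [FiniteDimensional ℝ D] : FiniteDimensional ℝ (ExteriorAlgebra ℝ D) :=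
  (finBasis ℝ D).ExteriorAlgebra.finiteDimensional_of_finite

/-- A submodule of the exterior algebra that contains `1` and is stable under the left
multiplications by a spanning set of vectors is everything. -/
lemma eq_top_of_ι_mul_mem (R : Submodule ℝ (ExteriorAlgebra ℝ D)) (h1 : 1 ∈ R) (S : Set D)
    (hS : Submodule.span ℝ S = ⊤) (h : ∀ φ ∈ S, ∀ ω ∈ R, ι ℝ φ * ω ∈ R) : R = ⊤ := by
  have h' : ∀ φ, ∀ ω ∈ R, ι ℝ φ * ω ∈ R := by
    intro φ ω hω
    have hφ : φ ∈ Submodule.span ℝ S := hS ▸ Submodule.mem_top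
    induction hφ using Submodule.span_induction with
    | mem φ hφ => exact h φ hφ ω hω
    | zero => simp
    | add φ ψ _ _ hφ hψ => rw [map_add, add_mul]; exact R.add_mem hφ hψ
    | smul r φ _ hφ => rw [map_smul, smul_mul_assoc]; exact R.smul_mem r hφ
  refine eq_top_iff.2 fun ω _ => ?_
  induction ω using CliffordAlgebra.left_induction with
  | algebraMap r => rw [Algebra.algebraMap_eq_smul_one]; exact R.smul_mem r h1
  | add ω η hω hη => exact R.add_mem (hω trivial) (hη trivial)
  | ι_mul ω φ hω => exact h' φ ω (hω trivial)

/-- The rank of a differential with `d x = d (y i) = 0` and `d (z i) = x (y i)` on the exterior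
algebra over the space with basis `x`, `y i`, `z i`. -/
lemma finrank_range_add [FiniteDimensional ℝ D]
    (d : ExteriorAlgebra ℝ D →ₗ[ℝ] ExteriorAlgebra ℝ D)
    (hone : d 1 = 0) (hmul : ∀ φ ω, d (ι ℝ φ * ω) = d (ι ℝ φ) * ω - ι ℝ φ * d ω)
    (n : ℕ) (x : D) (y z : Fin n → D) (hx : d (ι ℝ x) = 0) (hy : ∀ i, d (ι ℝ (y i)) = 0)
    (hz : ∀ i, d (ι ℝ (z i)) = ι ℝ x * ι ℝ (y i))
    (hspan : Submodule.span ℝ ({x} ∪ (Set.range y ∪ Set.range z)) = ⊤)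
    (hD : finrank ℝ D = 2 * n + 1) :
    finrank ℝ (LinearMap.range d) + (2 * n + 1).choose n = 4 ^ n := by
  obtain ⟨M, _, _, _, N, Φ, hM, hN, hΦ, h1, hyΦ, hzΦ⟩ := exists_model d hone hmul x n y z hy hz
  -- The decomposition `M ⊕ x M` of the exterior algebra.
  let Ψ : M × M →ₗ[ℝ] ExteriorAlgebra ℝ D :=
    Φ.coprod (LinearMap.mulLeft ℝ (ι ℝ x) ∘ₗ Φ)
  have hΨ : ∀ p, Ψ p = Φ p.1 + ι ℝ x * Φ p.2 := fun p => rfl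
  have swap : ∀ w : D, (∀ ω ∈ LinearMap.range Φ, ι ℝ w * ω ∈ LinearMap.range Φ) →
      ∀ ω ∈ LinearMap.range Ψ, ι ℝ w * ω ∈ LinearMap.range Ψ := by
    rintro w hw _ ⟨⟨a, b⟩, rfl⟩
    obtain ⟨a', ha⟩ := hw _ ⟨a, rfl⟩
    obtain ⟨b', hb⟩ := hw _ ⟨b, rfl⟩
    exact ⟨(a', -b'), by simp [hΨ, mul_add, ι_mul_ι_mul w x, ha, hb]⟩
  have hsurj : LinearMap.range Ψ = ⊤ := by
    refine eq_top_of_ι_mul_mem _ ?_ _ hspan ?_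
    · obtain ⟨m, hm⟩ := h1
      exact ⟨(m, 0), by simp [hΨ, hm]⟩
    · rintro _ (rfl | ⟨i, rfl⟩ | ⟨i, rfl⟩)
      · rintro _ ⟨⟨a, b⟩, rfl⟩
        exact ⟨(0, a), by simp [hΨ, mul_add, ι_mul_ι_mul_self]⟩
      · exact swap _ (hyΦ i)
      · exact swap _ (hzΦ i)
  -- Both sides are `2 * 4 ^ n`, so the surjection `Ψ` is injective; no independence of the images
  -- under `Φ` had to be tracked during the induction.
  have hdim : finrank ℝ (M × M) = finrank ℝ (ExteriorAlgebra ℝ D) := by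
    rw [finrank_exteriorAlgebra, finrank_prod, hM, hD, pow_succ, pow_mul]
    norm_num
    ring
  have hinj : Function.Injective Ψ :=
    (LinearMap.injective_iff_surjective_of_finrank_eq_finrank hdim).2
      (LinearMap.range_eq_top.1 hsurj)
  -- In the coordinates of `Ψ`, the differential is `(a, b) ↦ (0, N a)`.
  have hcomp : d ∘ₗ Ψ = (Ψ ∘ₗ LinearMap.inr ℝ M M ∘ₗ N) ∘ₗ LinearMap.fst ℝ M M := by
    refine LinearMap.ext fun p => ?_
    simp [hΨ, hmul, hx, hΦ, ι_mul_ι_mul_self]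
  have hrange : LinearMap.range d =
      (LinearMap.range N).map (Ψ ∘ₗ LinearMap.inr ℝ M M) := by
    rw [← LinearMap.range_comp_of_range_eq_top d hsurj, hcomp,
      LinearMap.range_comp_of_range_eq_top _ (LinearMap.range_eq_top.2 Prod.fst_surjective),
      ← LinearMap.comp_assoc,
      LinearMap.range_comp]
  have hinj' : Function.Injective (Ψ ∘ₗ LinearMap.inr ℝ M M) :=
    hinj.comp LinearMap.inr_injective
  rw [hrange, ← (Submodule.equivMapOfInjective _ hinj' _).finrank_eq, ← hM,
    ← N.finrank_range_add_finrank_ker, ← KernelPow.centralSum_one, ← hN 1, pow_one]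

end ExteriorPairs

/-- The dimension of the homology of a square-zero endomorphism. -/
lemma LinearMap.finrank_homology {A : Type*} [AddCommGroup A] [Module ℝ A] [FiniteDimensional ℝ A]
    (d : A →ₗ[ℝ] A) (hd : ∀ a, d (d a) = 0) :
    finrank ℝ (LinearMap.ker d ⧸ (LinearMap.range d).submoduleOf (LinearMap.ker d)) +
      2 * finrank ℝ (LinearMap.range d) = finrank ℝ A := by
  have hle : LinearMap.range d ≤ LinearMap.ker d := by
    rintro _ ⟨a, rfl⟩
    exact hd a
  -- The homology has dimension `dim ker d - rank d`; rank-nullity then eliminates `dim ker d`.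
  have h1 := ((LinearMap.range d).submoduleOf (LinearMap.ker d)).finrank_quotient_add_finrank
  rw [(Submodule.submoduleOfEquivOfLe hle).finrank_eq] at h1
  have h2 := d.finrank_range_add_finrank_ker
  omega

/-! ### The dual basis of the Lie algebra of a star -/

namespace DaniMainkar

section Star

variable {n : ℕ}

lemma star_adj (i : Fin n) :
    (SimpleGraph.starGraph (0 : Fin (n + 1))).Adj 0 i.succ := by
  simpa using (Fin.succ_ne_zero i).symm

/-- The linear forms `x_i^*`, for all vertices, and `x_{0,i}^*`, for all edges, of a star. -/
def starForm : Fin (n + 1) ⊕ Fin n →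
    Module.Dual ℝ (DaniMainkar (SimpleGraph.starGraph (0 : Fin (n + 1)))) :=
  Sum.elim (vertexForm _) fun i => edgeForm (star_adj i)

lemma wedge_swap {V : Type*} (v w : V → ℝ) : wedge w v = -wedge v w := by
  apply Subtype.ext
  rw [Submodule.coe_neg, coe_wedge, coe_wedge]
  exact eq_neg_of_add_eq_zero_left (ExteriorAlgebra.ι_add_mul_swap w v)

lemma minorForm_wedge_single {V : Type*} [DecidableEq V] (i j k l : V) :
    minorForm i j (wedge (Pi.single k 1) (Pi.single l 1)) =
      (if i = k ∧ j = l then 1 else 0) - (if j = k ∧ i = l then 1 else 0) := by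
  rw [minorForm_wedge]
  simp only [Pi.single_apply, ite_and, mul_ite, mul_one, mul_zero]
  congr 1 <;> split_ifs <;> rfl

/-- Modulo non-edges, a bivector is the combination of the edges of the star given by its
minors. -/
lemma sub_sum_minorForm_mem_nonEdges (ω : ⋀[ℝ]^2 (Fin (n + 1) → ℝ)) :
    ω - ∑ i : Fin n, minorForm 0 i.succ ω •
        wedge (Pi.single (0 : Fin (n + 1)) (1 : ℝ)) (Pi.single i.succ 1) ∈
      nonEdges (SimpleGraph.starGraph (0 : Fin (n + 1))) := by
  have hs : Submodule.span ℝ (Set.range fun i : Fin (n + 1) => (Pi.single i 1 : _ → ℝ)) = ⊤ := by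
    rw [← (Pi.basisFun ℝ (Fin (n + 1))).span_eq]
    congr 2
    ext i : 1
    rw [Pi.basisFun_apply]
  have hω : ω ∈ Submodule.span ℝ
      (exteriorPower.ιMulti ℝ 2 '' {a | Set.range a ⊆
        Set.range fun i : Fin (n + 1) => (Pi.single i 1 : _ → ℝ)}) := by
    rw [exteriorPower.ιMulti_span_of_span ℝ 2 _ hs]
    trivial
  induction hω using Submodule.span_induction with
  | zero => simp
  | add ω η _ _ hω hη =>
    simp only [map_add, add_smul, Finset.sum_add_distrib, add_sub_add_comm]
    exact Submodule.add_mem _ hω hη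
  | smul r ω _ hω =>
    simp only [map_smul, smul_eq_mul, mul_smul, ← Finset.smul_sum, ← smul_sub]
    exact Submodule.smul_mem _ r hω
  | mem ω h =>
    obtain ⟨a, ha, rfl⟩ := h
    obtain ⟨k, hk⟩ := ha ⟨0, rfl⟩
    obtain ⟨l, hl⟩ := ha ⟨1, rfl⟩
    have hwedge : exteriorPower.ιMulti ℝ 2 a = wedge (Pi.single k 1) (Pi.single l 1) := by
      rw [wedge]
      congr 1
      ext i : 1
      fin_cases i
      · exact hk.symm
      · exact hl.symm
    rw [hwedge]
    simp only [minorForm_wedge_single]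
    induction k using Fin.cases with
    | zero =>
      induction l using Fin.cases with
      | zero =>
        simp only [Fin.succ_ne_zero, false_and, and_false, if_false, sub_zero, zero_smul,
          Finset.sum_const_zero]
        exact Submodule.subset_span ⟨0, 0, by simp, rfl⟩
      | succ l => simp [Fin.succ_ne_zero]
    | succ k =>
      induction l using Fin.cases with
      | zero =>
        -- The bivector is an edge with reversed orientation, so its only nonzero minor is `-1`, at
        -- `i = k`.
        rw [wedge_swap, Finset.sum_eq_single k]
        · simp only [(Fin.succ_ne_zero _).symm, false_and, if_false, and_self, if_true, zero_sub]
          have h0 : ∀ w : ⋀[ℝ]^2 (Fin (n + 1) → ℝ), -w - (-1 : ℝ) • w = 0 := fun w =>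
            sub_eq_zero.2 (neg_one_smul ℝ w).symm
          rw [h0]
          exact Submodule.zero_mem _
        · intro i _ hik
          simp [(Fin.succ_ne_zero _).symm, hik]
        · simp
      | succ l =>
        simp only [(Fin.succ_ne_zero _).symm, false_and, and_false, if_false, sub_zero, zero_smul,
          Finset.sum_const_zero]
        exact Submodule.subset_span ⟨k.succ, l.succ, by simp, rfl⟩

/-- By duality it suffices that a vector killed by all these forms is zero. Such a vector has zero
vertex coordinates, and its bivector part has zero minors along all edges, so that part lies in
`nonEdges`. -/
lemma span_starForm : Submodule.span ℝ (Set.range (starForm (n := n))) = ⊤ := by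
  rw [← Subspace.dualCoannihilator_dualAnnihilator_eq
    (W := Submodule.span ℝ (Set.range (starForm (n := n)))), Submodule.dualAnnihilator_eq_top_iff,
    eq_bot_iff]
  intro v hv
  rw [Submodule.mem_dualCoannihilator] at hv
  have hform : ∀ i, starForm i v = 0 := fun i => hv _ (Submodule.subset_span ⟨i, rfl⟩)
  obtain ⟨u, q⟩ := v
  obtain ⟨ω, rfl⟩ := Submodule.mkQ_surjective _ q
  have hu : u = 0 := funext fun i => hform (Sum.inl i)
  have hω : ∀ i : Fin n, minorForm 0 i.succ ω = 0 := fun i => hform (Sum.inr i)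
  have h := sub_sum_minorForm_mem_nonEdges ω
  simp only [hω, zero_smul, Finset.sum_const_zero, sub_zero] at h
  refine (Submodule.mem_bot ℝ).2 ?_
  exact Prod.ext hu ((Submodule.Quotient.mk_eq_zero _).2 h)

/-- Evaluating a vanishing combination at each `x_j`, and at the class of each `x_0 ∧ x_j`, isolates
a single coefficient. -/
lemma linearIndependent_starForm : LinearIndependent ℝ (starForm (n := n)) := by
  rw [Fintype.linearIndependent_iff]
  intro c hc
  have hv : ∀ v : DaniMainkar (SimpleGraph.starGraph (0 : Fin (n + 1))),
      ∑ i, c (Sum.inl i) * vertexForm _ i v +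
        ∑ i : Fin n, c (Sum.inr i) * edgeForm (star_adj i) v = 0 := by
    intro v
    have h := LinearMap.congr_fun hc v
    rw [Fintype.sum_sum_type] at h
    simpa only [starForm, Sum.elim_inl, Sum.elim_inr, LinearMap.add_apply, LinearMap.sum_apply,
      LinearMap.smul_apply, smul_eq_mul, LinearMap.zero_apply] using h
  rintro (j | j)
  · have h := hv (Pi.single j 1, 0)
    have h1 : ∀ i, vertexForm (SimpleGraph.starGraph (0 : Fin (n + 1))) i
        ((Pi.single j 1, 0) : (Fin (n + 1) → ℝ) × _) = if i = j then 1 else 0 :=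
      fun i => Pi.single_apply _ _ _
    have h2 : ∀ i : Fin n, edgeForm (star_adj i)
        ((Pi.single j 1, 0) : (Fin (n + 1) → ℝ) × _) = 0 := fun i =>
      map_zero ((nonEdges _).liftQ (minorForm 0 i.succ) (nonEdges_le_ker_minorForm (star_adj i)))
    simpa [h1, h2] using h
  · set q := (nonEdges (SimpleGraph.starGraph (0 : Fin (n + 1)))).mkQ
      (wedge (Pi.single 0 1) (Pi.single j.succ 1))
    have h := hv (0, q)
    have h1 : ∀ i, vertexForm (SimpleGraph.starGraph (0 : Fin (n + 1))) i
        ((0, q) : (Fin (n + 1) → ℝ) × _) = 0 := fun i => rfl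
    have h2 : ∀ i : Fin n, edgeForm (star_adj i)
        ((0, q) : (Fin (n + 1) → ℝ) × _) = if i = j then 1 else 0 := fun i => by
      refine (minorForm_wedge_single 0 i.succ 0 j.succ).trans ?_
      simp
    simpa [h1, h2] using h

lemma finrank_dual_star :
    finrank ℝ (Module.Dual ℝ (DaniMainkar (SimpleGraph.starGraph (0 : Fin (n + 1))))) =
      2 * n + 1 := by
  rw [finrank_eq_card_basis (Basis.mk linearIndependent_starForm span_starForm.ge)]
  simp
  ring

end Star

end DaniMainkar

end
-- The total dimension of the cohomology
theorem mainTheorem6 (n : ℕ) (hn : 1 ≤ n) :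
    Module.finrank ℝ
        (CE.Cohomology (DaniMainkar (SimpleGraph.starGraph (0 : Fin (n + 1))))) =
      2 * (2 * n + 1).choose n := by
  let L := DaniMainkar (SimpleGraph.starGraph (0 : Fin (n + 1)))
  have hrank : Module.finrank ℝ (LinearMap.range (CE.differential L)) +
      (2 * n + 1).choose n = 4 ^ n :=
    ExteriorPairs.finrank_range_add (CE.differential L)
    (by rw [← map_one (algebraMap ℝ (CE.Cochain L)), CE.differential_algebraMap])
    CE.differential_ι_mul n
    (DaniMainkar.vertexForm _ 0) (fun i => DaniMainkar.vertexForm _ i.succ)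
    (fun i => DaniMainkar.edgeForm (DaniMainkar.star_adj i))
    (DaniMainkar.differential_vertexForm _) (fun i => DaniMainkar.differential_vertexForm _)
    (fun i => DaniMainkar.differential_edgeForm _)
    (by
      rw [eq_top_iff, ← DaniMainkar.span_starForm]
      refine Submodule.span_mono ?_
      rintro _ ⟨i | i, rfl⟩
      · induction i using Fin.cases with
        | zero => exact Or.inl rfl
        | succ i => exact Or.inr (Or.inl ⟨i, rfl⟩)
      · exact Or.inr (Or.inr ⟨i, rfl⟩))
    DaniMainkar.finrank_dual_star
  have hH : Module.finrank ℝ (CE.Cohomology L) +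
      2 * Module.finrank ℝ (LinearMap.range (CE.differential L)) =
      Module.finrank ℝ (CE.Cochain L) :=
    LinearMap.finrank_homology (CE.differential L) CE.differential_differential
  -- With the total dimension written as `4 ^ n * 2`, the powers of 4 cancel against twice the rank
  -- and leave twice the binomial coefficient.
  rw [ExteriorPairs.finrank_exteriorAlgebra, DaniMainkar.finrank_dual_star, pow_succ, pow_mul,
    show (2 : ℕ) ^ 2 = 4 from rfl] at hH
  change Module.finrank ℝ (CE.Cohomology L) = _
  omega
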